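/- Let $X$ be a standard Borel space and $\mathcal R$ a Borel equivalence relation on $X$ with countable classes. Definitions. A Borel equivalence relation on a standard Borel space is *smooth* if it admits a fundamental domain, i.e. a Borel set meeting each class in exactly one point. $\mathcal R$ is *treeable* if there is a Borel graph on $X$ (a symmetric irreflexive Borel subset of $X\times X$) that is acyclic and whose connected components are exactly the $\mathcal R$-classes. An *$\mathcal R$-space* is a standard Borel space $F$ with a countable-to-one Borel map $\pi:F\to X$ and a Borel map $((x,y),t)\mapsto (x,y)\cdot t\in F$, defined for $(x,y)\in\mathcal R$ and $\pi(t)=y$, such that $\pi((x,y)\cdot t)=x$, $(z,z)\cdot t=t$ and $(x,y)\cdot((y,z)\cdot t)=(x,z)\cdot t$. Then $\mathcal R_F$ is the equivalence relation on $F$ for which $f,g$ are equivalent iff $(\pi(f),\pi(g))\in\mathcal R$ and $(\pi(f),\pi(g))\cdot g=f$. A *partial section* is a Borel map $s:A\to F$ on a Borel set $A\subseteq X$ with $\pi\circ s=\mathrm{id}_A$; its *stabilizer* is the relation on $A$ identifying $x,y$ iff $s(x)\mathrel{\mathcal R_F}s(y)$. The action on $F$ is *quasi-free* if the stabilizer of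 every partial section is smooth. An *$\mathcal R$-arboretum* consists of two $\mathcal R$-spaces $\mathcal A^0$ (vertices, with surjective projection) and $\mathcal A^1$ (oriented edges; fibres may be empty) and Borel, fibre-preserving, $\mathcal R$-equivariant maps origin, terminus $\mathcal A^1\to\mathcal A^0$ and edge reversal $\mathcal A^1\to\mathcal A^1$ (a fixed-point-free involution exchanging origin and terminus) such that for every $x\in X$ the graph $\mathcal A_x$ formed by the fibres over $x$ is a tree. $\mathcal R$ acts quasi-freely on $\mathcal A$ if it acts quasi-freely on $\mathcal A^0$. Theorem. $\mathcal R$ is treeable if and only if there exists an $\mathcal R$-arboretum on which $\mathcal R$ acts quasi-freely. Moreover, the action of $\mathcal R$ on an $\mathcal R$-space $F$ is quasi-free if and only if $\mathcal R_F$ is smooth; in particular, quasi-freeness on an arboretum $\mathcal A$ means that $\mathcal R_{\mathcal A^0}$ is smooth. -/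

import Mathlib

universe u

namespace BorelTrees

/-- A countable Borel equivalence relation: Borel as a subset of `X × X`, with countable classes. -/
structure IsCountableBorel {X : Type u} [MeasurableSpace X] (R : Setoid X) : Prop where
  measurableSet : MeasurableSet {p : X × X | R p.1 p.2}
  countable : ∀ x, {y | R x y}.Countable

/-- A fundamental domain: a Borel set meeting every class in exactly one point. -/
def IsFundamentalDomain {Y : Type u} [MeasurableSpace Y] (S : Setoid Y) (D : Set Y) : Prop :=
  MeasurableSet D ∧ ∀ y, ∃! d, d ∈ D ∧ S y d

/-- A relation is smooth if it has a (Borel) fundamental domain. -/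
def IsSmooth {Y : Type u} [MeasurableSpace Y] (S : Setoid Y) : Prop :=
  ∃ D, IsFundamentalDomain S D

/-- `G` is a treeing of `R`: a Borel graph on `X`, without cycles, whose connected components are
exactly the classes of `R`. -/
structure IsTreeing {X : Type u} [MeasurableSpace X] (R : Setoid X) (G : SimpleGraph X) :
    Prop where
  measurableSet : MeasurableSet {p : X × X | G.Adj p.1 p.2}
  reachable_iff : ∀ x y, G.Reachable x y ↔ R x y
  isAcyclic : G.IsAcyclic

/-- `R` is treeable if it admits a treeing. -/
def IsTreeable {X : Type u} [MeasurableSpace X] (R : Setoid X) : Prop :=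
  ∃ G : SimpleGraph X, IsTreeing R G

/-- A standard Borel space `F` with a countable-to-one Borel projection to `X`, together with a
left action of `R`: for `(x, y) ∈ R` and `t` in the fibre of `y`, the point `(x, y) · t` is
`act x y t`, in the fibre of `x`. Empty fibres are allowed here (the edge space of a one-vertex tree
is empty); surjectivity of the projection is a separate condition. -/
structure RSpace {X : Type u} [MeasurableSpace X] (R : Setoid X) where
  carrier : Type u
  [measurableSpace : MeasurableSpace carrier]
  [standardBorel : StandardBorelSpace carrier]
  proj : carrier → X
  measurable_proj : Measurable proj
  countable_fibre : ∀ x, (proj ⁻¹' {x}).Countable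
  act : ∀ (x y : X) (t : carrier), R x y → proj t = y → carrier
  measurable_act : Measurable
    (fun q : {q : (X × X) × carrier // R q.1.1 q.1.2 ∧ proj q.2 = q.1.2} =>
      act q.1.1.1 q.1.1.2 q.1.2 q.2.1 q.2.2)
  proj_act : ∀ x y t (h : R x y) (ht : proj t = y), proj (act x y t h ht) = x
  act_self : ∀ z t (ht : proj t = z), act z z t (R.refl z) ht = t
  act_act : ∀ x y z t (hxy : R x y) (hyz : R y z) (ht : proj t = z),
    act x y (act y z t hyz ht) hxy (proj_act y z t hyz ht) = act x z t (R.trans hxy hyz) ht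

attribute [instance] RSpace.measurableSpace RSpace.standardBorel

namespace RSpace

variable {X : Type u} [MeasurableSpace X] {R : Setoid X}

/-- The relation `R_F` on `F` generated by the action: `f ~ g` iff `(π f, π g) · g = f`. -/
def orbitRel (F : RSpace R) : Setoid F.carrier where
  r f g := ∃ h : R (F.proj f) (F.proj g), F.act (F.proj f) (F.proj g) g h rfl = f
  iseqv := by
    refine ⟨fun f => ⟨R.refl _, F.act_self _ _ _⟩, ?_, ?_⟩
    · rintro f g ⟨h, e⟩
      refine ⟨R.symm h, ?_⟩
      have := F.act_act (F.proj g) (F.proj f) (F.proj g) g (R.symm h) h rfl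
      rw [F.act_self] at this
      simpa only [e] using this
    · rintro f g k ⟨h, e⟩ ⟨h', e'⟩
      refine ⟨R.trans h h', ?_⟩
      have := F.act_act (F.proj f) (F.proj g) (F.proj k) k h h' rfl
      rw [← this]
      simpa only [e'] using e

/-- `s` is a partial Borel section of `F`, defined on the Borel set `A ⊆ X`. -/
structure IsPartialSection (F : RSpace R) (A : Set X) (s : A → F.carrier) : Prop where
  measurableSet_domain : MeasurableSet A
  measurable : Measurable s
  proj_eq : ∀ a : A, F.proj (s a) = a

/-- The stabilizer of a partial section `s : A → F`: the relation on `A` identifying `x` and `y`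
when `s x` and `s y` are `R_F`-equivalent. -/
def stabilizer (F : RSpace R) {A : Set X} (s : A → F.carrier) : Setoid A :=
  F.orbitRel.comap s

/-- The action is quasi-free if the stabilizer of every partial section is smooth. -/
def IsQuasiFree (F : RSpace R) : Prop :=
  ∀ (A : Set X) (s : A → F.carrier), F.IsPartialSection A s → IsSmooth (F.stabilizer s)

/-- The action is smooth if `R_F` is smooth. -/
def IsSmoothAction (F : RSpace R) : Prop :=
  IsSmooth F.orbitRel

/-- A morphism: a Borel, fibre-preserving, `R`-equivariant map. -/
structure IsMorphism (F F' : RSpace R) (f : F.carrier → F'.carrier) : Prop where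
  measurable : Measurable f
  proj_eq : ∀ t, F'.proj (f t) = F.proj t
  map_act : ∀ x y t (h : R x y) (ht : F.proj t = y),
    f (F.act x y t h ht) = F'.act x y (f t) h ((proj_eq t).trans ht)

end RSpace

/-- A Borel field of graphs with an action of `R`. Graphs are given by oriented edges, with origin,
terminus and a fixed-point-free edge reversal. -/
structure GraphField {X : Type u} [MeasurableSpace X] (R : Setoid X) where
  vert : RSpace R
  edge : RSpace R
  vert_surjective : Function.Surjective vert.proj
  origin : edge.carrier → vert.carrier
  terminus : edge.carrier → vert.carrier
  rev : edge.carrier → edge.carrier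
  origin_morphism : edge.IsMorphism vert origin
  terminus_morphism : edge.IsMorphism vert terminus
  rev_morphism : edge.IsMorphism edge rev
  rev_rev : ∀ e, rev (rev e) = e
  rev_ne : ∀ e, rev e ≠ e
  origin_rev : ∀ e, origin (rev e) = terminus e

namespace GraphField

variable {X : Type u} [MeasurableSpace X] {R : Setoid X}

/-- The simple graph underlying the fibre over `x`: two distinct vertices in the fibre are
adjacent when some edge joins them. -/
def fibreGraph (A : GraphField R) (x : X) : SimpleGraph {v : A.vert.carrier // A.vert.proj v = x} where
  Adj v w := v ≠ w ∧ ∃ e, A.origin e = v ∧ A.terminus e = w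
  symm := ⟨by
    rintro v w ⟨hne, e, h₁, h₂⟩
    refine ⟨hne.symm, A.rev e, (A.origin_rev e).trans h₂, ?_⟩
    rw [← A.origin_rev, A.rev_rev, h₁]⟩
  loopless := ⟨fun _ h => h.1 rfl⟩

/-- All fibres are trees: no loop (circuit of length 1), no two distinct edges with the same origin
and terminus (circuit of length 2), and the underlying simple graph of every fibre is a tree
(nonempty, connected, without circuits of length at least 3). -/
structure IsArboretum (A : GraphField R) : Prop where
  no_loop : ∀ e, A.origin e ≠ A.terminus e
  no_multiple : ∀ e e', A.origin e = A.origin e' → A.terminus e = A.terminus e' → e = e'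
  isTree : ∀ x, (A.fibreGraph x).IsTree

/-- `R` acts quasi-freely on a field of graphs if it does so on the vertex space. -/
def IsQuasiFree (A : GraphField R) : Prop :=
  A.vert.IsQuasiFree

end GraphField

end BorelTrees

/-!
Countable-to-one Borel maps are governed by the Lusin–Novikov theorem: the domain is a countable
union of Borel sets on which the map is injective, since otherwise one can split it repeatedly into
small disjoint pieces that share a value, and obtain a Cantor set inside a fibre. This turns the
projection of an `R`-space into countably many partial sections, so that fundamental domains of
their stabilizers add up to one of the orbit relation, and conversely the orbit relation pulls back
to the stabilizers.

Restricting a treeing to the classes of `R` gives an arboretum on whose vertices `(x, y)` the action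
only moves `x`, hence is smooth. Conversely, let the action on the vertices of an arboretum be
smooth. An orbit of vertices meets each fibre in at most one point, so the quotient by the action is
a Borel graph on a fundamental domain whose restriction to the part lying over a class of `R` is
isomorphic to a fibre, hence a tree. Such a treeing of the quotient is lifted to the vertex space by
attaching leaves, and then contracted onto the image of a Borel section `X → A⁰` along the edges
leading from each point to a nearest point of the section.
-/

open Set MeasureTheory Topology
open scoped ENNReal Function

namespace BorelTrees

section SigmaInjective

/-- `A` is a countable union of Borel sets on which `f` is injective. In particular `A` itself is
Borel. -/
def IsSigmaInjOn {Z X : Type*} [MeasurableSpace Z] (f : Z → X) (A : Set Z) : Prop :=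
  ∃ C : ℕ → Set Z, (∀ n, MeasurableSet (C n)) ∧ (∀ n, InjOn f (C n)) ∧ A = ⋃ n, C n

namespace IsSigmaInjOn

variable {Z X : Type*} [MeasurableSpace Z] {f : Z → X} {A B : Set Z}

theorem measurableSet (h : IsSigmaInjOn f A) : MeasurableSet A := by
  obtain ⟨C, hC, -, rfl⟩ := h
  exact MeasurableSet.iUnion hC

theorem of_injOn (hA : MeasurableSet A) (h : InjOn f A) : IsSigmaInjOn f A :=
  ⟨fun _ => A, fun _ => hA, fun _ => h, (iUnion_const A).symm⟩

theorem iUnion {ι : Type*} [Countable ι] {A : ι → Set Z} (h : ∀ i, IsSigmaInjOn f (A i)) :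
    IsSigmaInjOn f (⋃ i, A i) := by
  choose C hC hinj hA using h
  rcases isEmpty_or_nonempty ι with _ | _
  · rw [iUnion_of_empty]
    exact of_injOn .empty (injOn_empty f)
  · obtain ⟨e, he⟩ := exists_surjective_nat (ι × ℕ)
    refine ⟨fun n => C (e n).1 (e n).2, fun n => hC _ _, fun n => hinj _ _, ?_⟩
    rw [he.iUnion_comp fun p : ι × ℕ => C p.1 p.2, iUnion_prod']
    exact iUnion_congr hA

theorem union (hA : IsSigmaInjOn f A) (hB : IsSigmaInjOn f B) : IsSigmaInjOn f (A ∪ B) := by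
  rw [union_eq_iUnion]
  exact iUnion fun b => by cases b <;> assumption

theorem image_val {A : Set Z} (hA : MeasurableSet A) {B : Set A}
    (h : IsSigmaInjOn (fun a : A => f a) B) : IsSigmaInjOn f (Subtype.val '' B) := by
  obtain ⟨C, hC, hinj, rfl⟩ := h
  refine ⟨fun n => Subtype.val '' C n, fun n => hA.subtype_image (hC n), fun n => ?_,
    image_iUnion⟩
  rintro _ ⟨a, ha, rfl⟩ _ ⟨b, hb, rfl⟩ hab
  rw [hinj n ha hb hab]

end IsSigmaInjOn

/-- Off a countable union of Borel sets on which `f` is injective, every fibre of `f` misses some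
member of the family `U`. Cantor schemes with levels that are not negligible produce uncountable
fibres. -/
def IsNegligible {Z X ι : Type*} [MeasurableSpace Z] (f : Z → X) (U : ι → Set Z) : Prop :=
  ∃ N, IsSigmaInjOn f N ∧ ∀ x, ∃ i, U i ∩ f ⁻¹' {x} ⊆ N

theorem exists_forall_nonempty_of_not_isNegligible {Z X ι : Type*} [MeasurableSpace Z] {f : Z → X}
    {U : ι → Set Z} (h : ¬ IsNegligible f U) : ∃ x, ∀ i, (U i ∩ f ⁻¹' {x}).Nonempty := by
  by_contra! hU
  exact h ⟨∅, .of_injOn .empty (injOn_empty f), fun x => (hU x).imp fun _ hi => hi.subset⟩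

theorem IsNegligible.isSigmaInjOn_univ {Z X ι : Type*} [MeasurableSpace Z] {f : Z → X}
    (h : IsNegligible f fun _ : ι => univ) : IsSigmaInjOn f univ := by
  obtain ⟨N, hN, hx⟩ := h
  have hN_univ : N = univ := eq_univ_of_forall fun z =>
    (hx (f z)).elim fun _ hi => hi ⟨mem_univ z, rfl⟩
  exact hN_univ ▸ hN

end SigmaInjective

section Separation

theorem analyticSet_inter {X : Type*} [TopologicalSpace X] [T2Space X] {A B : Set X}
    (hA : AnalyticSet A) (hB : AnalyticSet B) : AnalyticSet (A ∩ B) := by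
  rw [inter_eq_iInter]
  exact AnalyticSet.iInter fun b => by cases b <;> assumption

variable {X ι : Type*} [TopologicalSpace X] [PolishSpace X] [MeasurableSpace X] [BorelSpace X]
  {M : ι → Set X}

theorem exists_measurable_superset_inter_biInter_eq_empty (hM : ∀ i, AnalyticSet (M i))
    (s : Finset ι) {A : Set X} (hA : AnalyticSet A) (h : A ∩ ⋂ i ∈ s, M i = ∅) :
    ∃ B : ι → Set X, (∀ i, MeasurableSet (B i)) ∧ (∀ i, M i ⊆ B i) ∧ A ∩ ⋂ i ∈ s, B i = ∅ := by
  classical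
  induction s using Finset.induction_on generalizing A with
  | empty =>
    exact ⟨fun _ => univ, fun _ => .univ, fun _ => subset_univ _, by simpa using h⟩
  | insert i s hi ih =>
    rw [Finset.set_biInter_insert, ← inter_assoc] at h
    obtain ⟨B, hB, hMB, he⟩ := ih (analyticSet_inter hA (hM i)) h
    have hBs : MeasurableSet (⋂ j ∈ s, B j) := s.measurableSet_biInter fun j _ => hB j
    have hd : Disjoint (M i) (A ∩ ⋂ j ∈ s, B j) := by
      rwa [disjoint_iff_inter_eq_empty, inter_left_comm, ← inter_assoc]
    obtain ⟨u, hMu, hdu, hu⟩ :=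
      (hM i).measurablySeparable (analyticSet_inter hA hBs.analyticSet) hd
    have hupdate : ⋂ j ∈ s, Function.update B i u j = ⋂ j ∈ s, B j :=
      iInter₂_congr fun j hj => Function.update_of_ne (ne_of_mem_of_not_mem hj hi) u B
    refine ⟨Function.update B i u, (Function.forall_update_iff B fun _ => MeasurableSet).2
      ⟨hu, fun j _ => hB j⟩, (Function.forall_update_iff B fun j b => M j ⊆ b).2
      ⟨hMu, fun j _ => hMB j⟩, ?_⟩
    rw [Finset.set_biInter_insert, hupdate, Function.update_self, inter_left_comm, inter_comm]
    exact hdu.inter_eq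

theorem exists_measurable_superset_iInter_eq_empty [Finite ι] (hM : ∀ i, AnalyticSet (M i))
    (h : ⋂ i, M i = ∅) :
    ∃ B : ι → Set X, (∀ i, MeasurableSet (B i)) ∧ (∀ i, M i ⊆ B i) ∧ ⋂ i, B i = ∅ := by
  have := Fintype.ofFinite ι
  simpa using exists_measurable_superset_inter_biInter_eq_empty hM Finset.univ
    MeasurableSet.univ.analyticSet (by simpa using h)

end Separation

section LusinNovikov

/-- The set `M i` of the values that `f` takes twice on `U i \ N` is analytic. These sets have empty
intersection, hence so do Borel sets containing them, and `f` is injective on the part of `U i \ N`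
lying outside the `i`-th of the latter. -/
theorem isNegligible_of_exists_subsingleton {Z X ι : Type*} [MeasurableSpace Z]
    [StandardBorelSpace Z] [MeasurableSpace X] [StandardBorelSpace X] [Finite ι] {f : Z → X}
    (hf : Measurable f) {U : ι → Set Z} (hU : ∀ i, MeasurableSet (U i)) {N : Set Z}
    (hN : IsSigmaInjOn f N) (h : ∀ x, ∃ i, ((U i \ N) ∩ f ⁻¹' {x}).Subsingleton) :
    IsNegligible f U := by
  let := upgradeStandardBorel X
  let M (i : ι) : Set X := (fun p : Z × Z => f p.1) ''
    {p | p.1 ∈ U i \ N ∧ p.2 ∈ U i \ N ∧ p.1 ≠ p.2 ∧ f p.1 = f p.2}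
  have hUN (i : ι) : MeasurableSet (U i \ N) := (hU i).diff hN.measurableSet
  have hM (i : ι) : AnalyticSet (M i) := by
    let := upgradeStandardBorel Z
    refine MeasurableSet.analyticSet_image ?_ (hf.comp measurable_fst)
    exact (measurable_fst (hUN i)).inter <| (measurable_snd (hUN i)).inter <|
      (measurableSet_eq_fun measurable_fst measurable_snd).compl.inter <|
      measurableSet_eq_fun (hf.comp measurable_fst) (hf.comp measurable_snd)
  have hM_empty : ⋂ i, M i = ∅ := by
    refine eq_empty_of_forall_notMem fun x hx => ?_
    obtain ⟨i, hi⟩ := h x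
    obtain ⟨⟨z, w⟩, ⟨hz, hw, hne, hzw⟩, rfl⟩ := mem_iInter.1 hx i
    exact hne (hi ⟨hz, rfl⟩ ⟨hw, hzw.symm⟩)
  obtain ⟨B, hB, hMB, hB_empty⟩ := exists_measurable_superset_iInter_eq_empty hM hM_empty
  have hinj (i : ι) : InjOn f ((U i \ N) ∩ f ⁻¹' (B i)ᶜ) := by
    intro z hz w hw hzw
    by_contra hne
    exact hz.2 (hMB i ⟨(z, w), ⟨hz.1, hw.1, hne, hzw⟩, rfl⟩)
  refine ⟨N ∪ ⋃ i, (U i \ N) ∩ f ⁻¹' (B i)ᶜ, hN.union <| .iUnion fun i =>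
    .of_injOn ((hUN i).inter (hf (hB i).compl)) (hinj i), fun x => ?_⟩
  obtain ⟨i, hi⟩ : ∃ i, x ∉ B i := not_forall.1 fun hx => hB_empty.subset (mem_iInter.2 hx)
  refine ⟨i, ?_⟩
  rintro z ⟨hz, rfl⟩
  by_cases hzN : z ∈ N
  · exact .inl hzN
  · exact .inr (mem_iUnion.2 ⟨i, ⟨hz, hzN⟩, hi⟩)

/-- Two small disjoint open sets, indexed by `Bool`, deep inside `U`: one splitting step in the
construction of a Cantor scheme. -/
structure IsBinaryRefinement {Z : Type*} [MetricSpace Z] (δ : ℝ≥0∞) (U : Set Z)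
    (V : Bool → Set Z) : Prop where
  isOpen : ∀ b, IsOpen (V b)
  closure_subset : ∀ b, closure (V b) ⊆ U
  ediam_le : ∀ b, Metric.ediam (V b) ≤ δ
  disjoint : Disjoint (V false) (V true)

section Metric

variable {Z : Type*} [MetricSpace Z]

theorem exists_mem_countableBasis_small [SecondCountableTopology Z] {a : Z} {O : Set Z}
    (hO : O ∈ 𝓝 a) {δ : ℝ≥0∞} (hδ : δ ≠ 0) :
    ∃ V ∈ TopologicalSpace.countableBasis Z, a ∈ V ∧ closure V ⊆ O ∧ Metric.ediam V ≤ δ := by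
  have hball : O ∩ Metric.eball a (δ / 2) ∈ 𝓝 a :=
    Filter.inter_mem hO (Metric.eball_mem_nhds a (ENNReal.half_pos hδ))
  obtain ⟨K, ⟨hK, hKc⟩, hKO⟩ := (closed_nhds_basis a).mem_iff.1 hball
  obtain ⟨V, hV, haV, hVK⟩ := (TopologicalSpace.isBasis_countableBasis Z).mem_nhds_iff.1 hK
  refine ⟨V, hV, haV, (closure_minimal hVK hKc).trans (hKO.trans inter_subset_left), ?_⟩
  calc Metric.ediam V ≤ Metric.ediam (Metric.eball a (δ / 2)) :=
        Metric.ediam_mono (hVK.trans (hKO.trans inter_subset_right))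
    _ ≤ 2 * (δ / 2) := Metric.ediam_eball_le
    _ = δ := ENNReal.mul_div_cancel two_ne_zero ENNReal.ofNat_ne_top

theorem exists_isBinaryRefinement [SecondCountableTopology Z] {U : Set Z} (hU : IsOpen U)
    {δ : ℝ≥0∞} (hδ : δ ≠ 0) {a b : Z} (ha : a ∈ U) (hb : b ∈ U) (hab : a ≠ b) :
    ∃ V : Bool → TopologicalSpace.countableBasis Z, IsBinaryRefinement δ U (fun i => V i) ∧
      a ∈ (V false : Set Z) ∧ b ∈ (V true : Set Z) := by
  obtain ⟨A, B, hA, hB, haA, hbB, hAB⟩ := t2_separation hab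
  obtain ⟨V, hV, haV, hVA, hVδ⟩ :=
    exists_mem_countableBasis_small ((hU.inter hA).mem_nhds ⟨ha, haA⟩) hδ
  obtain ⟨W, hW, hbW, hWB, hWδ⟩ :=
    exists_mem_countableBasis_small ((hU.inter hB).mem_nhds ⟨hb, hbB⟩) hδ
  have hVW : Disjoint V W :=
    hAB.mono ((subset_closure.trans hVA).trans inter_subset_right)
      ((subset_closure.trans hWB).trans inter_subset_right)
  refine ⟨fun i => cond i ⟨W, hW⟩ ⟨V, hV⟩, ⟨?_, ?_, ?_, ?_⟩, haV, hbW⟩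
  · exact fun i => TopologicalSpace.isOpen_of_mem_countableBasis (Subtype.prop _)
  · rintro (_ | _)
    exacts [hVA.trans inter_subset_left, hWB.trans inter_subset_left]
  · rintro (_ | _)
    exacts [hVδ, hWδ]
  · exact hVW

theorem exists_refinement_not_isNegligible [SecondCountableTopology Z] [CompleteSpace Z]
    [MeasurableSpace Z] [BorelSpace Z] {X ι : Type*} [MeasurableSpace X] [StandardBorelSpace X]
    [Finite ι] {f : Z → X} (hf : Measurable f) {U : ι → Set Z} (hU : ∀ i, IsOpen (U i))
    (h : ¬ IsNegligible f U) {δ : ℝ≥0∞} (hδ : δ ≠ 0) :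
    ∃ V : ι → Bool → Set Z, (∀ i, IsBinaryRefinement δ (U i) (V i)) ∧
      ¬ IsNegligible f fun p : ι × Bool => V p.1 p.2 := by
  by_contra! hcon
  have : Countable (TopologicalSpace.countableBasis Z) :=
    (TopologicalSpace.countable_countableBasis Z).to_subtype
  let T := {V : ι → Bool → TopologicalSpace.countableBasis Z //
    ∀ i, IsBinaryRefinement δ (U i) fun b => V i b}
  choose N hN hVN using fun V : T => hcon (fun i b => V.1 i b) V.2
  refine h (isNegligible_of_exists_subsingleton hf (fun i => (hU i).measurableSet)
    (IsSigmaInjOn.iUnion hN) fun x => ?_)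
  by_contra! hx
  choose a ha b hb hab using hx
  choose V hV haV hbV using fun i =>
    exists_isBinaryRefinement (hU i) hδ (ha i).1.1 (hb i).1.1 (hab i)
  obtain ⟨⟨i, _ | _⟩, hi⟩ := hVN ⟨V, hV⟩ x
  · exact (ha i).1.2 (mem_iUnion.2 ⟨_, hi ⟨haV i, (ha i).2⟩⟩)
  · exact (hb i).1.2 (mem_iUnion.2 ⟨_, hi ⟨hbV i, (hb i).2⟩⟩)

theorem exists_scheme_of_not_isSigmaInjOn [SecondCountableTopology Z] [CompleteSpace Z]
    [MeasurableSpace Z] [BorelSpace Z] {X : Type*} [MeasurableSpace X] [StandardBorelSpace X]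
    {f : Z → X} (hf : Measurable f) (h : ¬ IsSigmaInjOn f univ) {δ : ℕ → ℝ≥0∞}
    (hδ : ∀ n, δ n ≠ 0) :
    ∃ A : List Bool → Set Z,
      (∀ l, IsBinaryRefinement (δ l.length) (A l) fun b => A (b :: l)) ∧
      ∀ n, ∃ x, ∀ l : List Bool, l.length = n → (A l ∩ f ⁻¹' {x}).Nonempty := by
  let Level (n : ℕ) := {U : List.Vector Bool n → Set Z // (∀ t, IsOpen (U t)) ∧ ¬ IsNegligible f U}
  have hnext (n : ℕ) (U : Level n) : ∃ U' : Level (n + 1), ∀ t,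
      IsBinaryRefinement (δ n) (U.1 t) fun b => U'.1 (b ::ᵥ t) := by
    obtain ⟨V, hV, hV'⟩ := exists_refinement_not_isNegligible hf U.2.1 U.2.2 (hδ n)
    refine ⟨⟨fun t => V t.tail t.head, fun t => (hV _).isOpen _, ?_⟩, fun t => hV t⟩
    rintro ⟨N, hN, hVN⟩
    exact hV' ⟨N, hN, fun x => (hVN x).elim fun t ht => ⟨(t.tail, t.head), ht⟩⟩
  choose next hnext using hnext
  let W (n : ℕ) : Level n :=
    Nat.rec ⟨fun _ => univ, fun _ => isOpen_univ, mt IsNegligible.isSigmaInjOn_univ h⟩ next n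
  refine ⟨fun l => (W l.length).1 ⟨l, rfl⟩, fun l => hnext l.length _ _, fun n => ?_⟩
  obtain ⟨x, hx⟩ := exists_forall_nonempty_of_not_isNegligible (W n).2.2
  exact ⟨x, by rintro l rfl; exact hx _⟩

theorem exists_uncountable_fibre_of_scheme [CompleteSpace Z] {X : Type*} [TopologicalSpace X]
    [T2Space X] {f : Z → X} (hf : Continuous f) {A : List Bool → Set Z} {δ : ℕ → ℝ≥0∞}
    (hδ : Filter.Tendsto δ Filter.atTop (𝓝 0))
    (hA : ∀ l, IsBinaryRefinement (δ l.length) (A l) fun b => A (b :: l))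
    (hfA : ∀ n, ∃ x, ∀ l : List Bool, l.length = n → (A l ∩ f ⁻¹' {x}).Nonempty) :
    ∃ x, ¬ (f ⁻¹' {x}).Countable := by
  choose x z hzA hzx using hfA
  have hdiam : CantorScheme.VanishingDiam A := fun α => by
    refine (Filter.tendsto_add_atTop_iff_nat 1).1 <|
      tendsto_of_tendsto_of_tendsto_of_le_of_le tendsto_const_nhds hδ (fun _ => zero_le) fun n => ?_
    simpa only [PiNat.res_length, PiNat.res_succ] using (hA (PiNat.res α n)).ediam_le (α n)
  have hanti : CantorScheme.ClosureAntitone A := fun l b => (hA l).closure_subset b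
  have hdisj : CantorScheme.Disjoint A := fun l => by
    rintro (_ | _) (_ | _) hbc
    exacts [absurd rfl hbc, (hA l).disjoint, (hA l).disjoint.symm, absurd rfl hbc]
  have hdom : (CantorScheme.inducedMap A).1 = univ :=
    hanti.map_of_vanishingDiam hdiam fun l => ⟨_, hzA l.length l rfl⟩
  let g (α : ℕ → Bool) : Z := (CantorScheme.inducedMap A).2 ⟨α, hdom ▸ mem_univ α⟩
  have hg_inj : Function.Injective g := fun α β h => congrArg Subtype.val (hdisj.map_injective h)
  have hg_lim (α : ℕ → Bool) : Filter.Tendsto x Filter.atTop (𝓝 (f (g α))) := by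
    have hz : Filter.Tendsto (fun n => z n (PiNat.res α n) (PiNat.res_length α n)) Filter.atTop
        (𝓝 (g α)) := by
      rw [tendsto_iff_edist_tendsto_0]
      exact tendsto_of_tendsto_of_tendsto_of_le_of_le tendsto_const_nhds (hdiam α)
        (fun _ => zero_le) fun n =>
          Metric.edist_le_ediam_of_mem (hzA _ _ _) (CantorScheme.map_mem _ n)
    exact ((hf.tendsto _).comp hz).congr fun n => hzx _ _ _
  refine ⟨f (g fun _ => false), fun hc => ?_⟩
  have : (univ : Set (ℕ → Bool)).Countable := (hc.preimage hg_inj).mono fun α _ =>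
    tendsto_nhds_unique (hg_lim α) (hg_lim _)
  rw [countable_univ_iff, ← Cardinal.mk_le_aleph0_iff] at this
  exact absurd this (by simp [Cardinal.aleph0_lt_continuum])

end Metric

variable {Z X : Type*} [MeasurableSpace Z] [StandardBorelSpace Z] [MeasurableSpace X]
  [StandardBorelSpace X] {f : Z → X} {B : Set Z}

theorem isSigmaInjOn_univ (hf : Measurable f) (hc : ∀ x, (f ⁻¹' {x}).Countable) :
    IsSigmaInjOn f univ := by
  let := upgradeStandardBorel X
  let τ₀ := upgradeStandardBorel Z
  obtain ⟨τ, hτ, hfτ, hP⟩ := hf.exists_continuous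
  have hB : @BorelSpace Z τ _ := by
    refine @BorelSpace.mk Z τ _ ?_
    rw [@borel_eq_borel_of_le Z τ τ₀.toTopologicalSpace hP inferInstance hτ]
    exact BorelSpace.measurable_eq
  let := τ
  let := TopologicalSpace.upgradeIsCompletelyMetrizable Z
  by_contra h
  obtain ⟨δ, -, hδ_pos, hδ⟩ := exists_seq_strictAnti_tendsto' (zero_lt_one' ℝ≥0∞)
  obtain ⟨A, hA, hfA⟩ := exists_scheme_of_not_isSigmaInjOn hf h fun n => (hδ_pos n).1.ne'
  obtain ⟨x, hx⟩ := exists_uncountable_fibre_of_scheme hfτ hδ hA hfA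
  exact hx (hc x)

/-- **Lusin–Novikov theorem**. -/
theorem isSigmaInjOn_of_countable_fibres (hf : Measurable f) (hB : MeasurableSet B)
    (hc : ∀ x, (B ∩ f ⁻¹' {x}).Countable) : IsSigmaInjOn f B := by
  have : StandardBorelSpace B := hB.standardBorel
  have hB' : IsSigmaInjOn (fun b : B => f b) univ :=
    isSigmaInjOn_univ (hf.comp measurable_subtype_coe) fun x =>
      ((hc x).preimage Subtype.val_injective).mono fun b hb => And.intro b.2 hb
  simpa using hB'.image_val hB

end LusinNovikov

section CountableToOne

variable {Z X : Type*} [MeasurableSpace Z] [StandardBorelSpace Z] [MeasurableSpace X]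
  [StandardBorelSpace X]

theorem countable_preimage_of_countable_fibres {Z X : Type*} {f : Z → X}
    (hc : ∀ x, (f ⁻¹' {x}).Countable) {A : Set X} (hA : A.Countable) : (f ⁻¹' A).Countable := by
  rw [← biUnion_preimage_singleton]
  exact hA.biUnion fun x _ => hc x

theorem measurableSet_image_of_countable_fibres {f : Z → X} {B : Set Z} (hf : Measurable f)
    (hB : MeasurableSet B) (hc : ∀ x, (B ∩ f ⁻¹' {x}).Countable) : MeasurableSet (f '' B) := by
  obtain ⟨C, hC, hinj, rfl⟩ := isSigmaInjOn_of_countable_fibres hf hB hc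
  rw [image_iUnion]
  exact MeasurableSet.iUnion fun n => (hC n).image_of_measurable_injOn hf (hinj n)

theorem measurableSet_setOf_exists {P : Set (X × Z)} (hP : MeasurableSet P)
    (hc : ∀ x, {z | (x, z) ∈ P}.Countable) : MeasurableSet {x | ∃ z, (x, z) ∈ P} := by
  have himage : {x | ∃ z, (x, z) ∈ P} = Prod.fst '' P := by
    ext x
    simp
  rw [himage]
  refine measurableSet_image_of_countable_fibres measurable_fst hP fun x =>
    ((hc x).image (Prod.mk x)).mono ?_
  rintro ⟨x', z⟩ ⟨hz, rfl⟩
  exact ⟨z, hz, rfl⟩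

end CountableToOne

section Smooth

/-- The saturation of `D`: the union of the `S`-classes that meet `D`. -/
def saturation {Y : Type*} (S : Setoid Y) (D : Set Y) : Set Y :=
  {y | ∃ d ∈ D, S y d}

/-- Keep from `D n` the points whose class meets no earlier `D m`. -/
theorem isSmooth_of_iUnion {Y : Type*} [MeasurableSpace Y] {S : Setoid Y} {D : ℕ → Set Y}
    (hD : ∀ n, MeasurableSet (D n)) (hDS : ∀ n, MeasurableSet (saturation S (D n)))
    (hinj : ∀ n, ∀ d ∈ D n, ∀ d' ∈ D n, S d d' → d = d') (hU : ⋃ n, saturation S (D n) = univ) :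
    IsSmooth S := by
  let B : ℕ → Set Y := disjointed fun n => saturation S (D n)
  have hB_inv {y z : Y} (h : S y z) {n : ℕ} (hy : y ∈ B n) : z ∈ B n := by
    refine disjointedRec (p := fun t => ∀ {y z}, S y z → y ∈ t → z ∈ t) ?_ ?_ h hy
    · exact fun t i ht y z hyz hy => ⟨ht hyz hy.1, fun ⟨d, hd, hzd⟩ =>
        hy.2 ⟨d, hd, S.trans hyz hzd⟩⟩
    · exact fun {y z} hyz ⟨d, hd, hyd⟩ => ⟨d, hd, S.trans (S.symm hyz) hyd⟩
  refine ⟨⋃ n, D n ∩ B n, .iUnion fun n => (hD n).inter (.disjointed hDS n), fun y => ?_⟩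
  obtain ⟨n, hyn⟩ : ∃ n, y ∈ B n := mem_iUnion.1 (by rw [iUnion_disjointed, hU]; exact mem_univ y)
  obtain ⟨d, hd, hyd⟩ := disjointed_subset _ n hyn
  refine ⟨d, ⟨mem_iUnion.2 ⟨n, hd, hB_inv hyd hyn⟩, hyd⟩, ?_⟩
  rintro e ⟨he, hye⟩
  obtain ⟨m, hem, heB⟩ := mem_iUnion.1 he
  obtain rfl : m = n := by
    by_contra hmn
    exact (disjoint_disjointed _ hmn).ne_of_mem heB (hB_inv hye hyn) rfl
  exact hinj m e hem d hd (S.trans (S.symm hye) hyd)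

theorem IsCountableBorel.comap {Y Z : Type*} [MeasurableSpace Y] [MeasurableSpace Z] {S : Setoid Y}
    (hS : IsCountableBorel S) {g : Z → Y} (hg : Measurable g) (hc : ∀ y, (g ⁻¹' {y}).Countable) :
    IsCountableBorel (S.comap g) where
  measurableSet :=
    ((hg.comp measurable_fst).prodMk (hg.comp measurable_snd)) hS.measurableSet
  countable z := countable_preimage_of_countable_fibres hc (hS.countable (g z))

variable {Y X : Type*} [MeasurableSpace Y] [StandardBorelSpace Y] [MeasurableSpace X]
  [StandardBorelSpace X] {S : Setoid Y}

theorem isSmooth_ker {f : Y → X} (hf : Measurable f) (hc : ∀ x, (f ⁻¹' {x}).Countable) :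
    IsSmooth (Setoid.ker f) := by
  obtain ⟨C, hC, hinj, hCU⟩ := isSigmaInjOn_univ hf hc
  have hsat (n : ℕ) : saturation (Setoid.ker f) (C n) = f ⁻¹' (f '' C n) := by
    ext y
    exact exists_congr fun d => and_congr_right fun _ => eq_comm
  refine isSmooth_of_iUnion hC (fun n => ?_) hinj ?_
  · rw [hsat]
    exact hf ((hC n).image_of_measurable_injOn hf (hinj n))
  · rw [← univ_subset_iff, hCU]
    exact iUnion_mono fun n => (subset_preimage_image f _).trans (hsat n).ge

theorem exists_measurable_rightInverse {f : Y → X} (hf : Measurable f)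
    (hc : ∀ x, (f ⁻¹' {x}).Countable) (hsurj : Function.Surjective f) :
    ∃ s : X → Y, Measurable s ∧ Function.RightInverse s f := by
  obtain ⟨T, hT, hTu⟩ := isSmooth_ker hf hc
  have : StandardBorelSpace T := hT.standardBorel
  let g : T → X := fun t => f t
  have hg_inj : Function.Injective g := fun t t' h =>
    Subtype.ext ((hTu t).unique ⟨t.2, rfl⟩ ⟨t'.2, h⟩)
  have hg_surj : Function.Surjective g := hsurj.forall.2 fun y =>
    let ⟨t, ⟨ht, hyt⟩, _⟩ := hTu y
    ⟨⟨t, ht⟩, hyt.symm⟩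
  have hg : MeasurableEmbedding g := (hf.comp measurable_subtype_coe).measurableEmbedding hg_inj
  refine ⟨fun x => (rangeSplitting g ⟨x, hg_surj x⟩ : T), measurable_subtype_coe.comp
    (hg.measurable_rangeSplitting.comp (measurable_id.subtype_mk)), fun x => ?_⟩
  exact apply_rangeSplitting g ⟨x, hg_surj x⟩

/-- **Lusin–Novikov uniformization theorem**. -/
theorem exists_measurable_uniformization {P : Set (X × Y)} (hP : MeasurableSet P)
    (hc : ∀ x, {y | (x, y) ∈ P}.Countable) (hne : ∀ x, ∃ y, (x, y) ∈ P) :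
    ∃ g : X → Y, Measurable g ∧ ∀ x, (x, g x) ∈ P := by
  have : StandardBorelSpace P := hP.standardBorel
  have hfib (x : X) : ((fun p : P => p.1.1) ⁻¹' {x}).Countable := by
    refine (((hc x).image (Prod.mk x)).preimage Subtype.val_injective).mono ?_
    rintro ⟨⟨x', y⟩, hy⟩ rfl
    exact ⟨y, hy, rfl⟩
  have hsurj : Function.Surjective fun p : P => p.1.1 := fun x =>
    let ⟨y, hy⟩ := hne x
    ⟨⟨(x, y), hy⟩, rfl⟩
  obtain ⟨s, hs, hsP⟩ :=
    exists_measurable_rightInverse (measurable_fst.comp measurable_subtype_coe) hfib hsurj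
  refine ⟨fun x => (s x).1.2, measurable_snd.comp (measurable_subtype_coe.comp hs), fun x => ?_⟩
  have hx : (s x).1 = (x, (s x).1.2) := Prod.ext (hsP x) rfl
  exact hx ▸ (s x).2

theorem IsCountableBorel.measurableSet_saturation (hS : IsCountableBorel S) {D : Set Y}
    (hD : MeasurableSet D) : MeasurableSet (saturation S D) :=
  measurableSet_setOf_exists (P := {p : Y × Y | p.2 ∈ D ∧ S p.1 p.2})
    ((measurable_snd hD).inter hS.measurableSet) fun y => (hS.countable y).mono fun _ h => h.2

theorem IsCountableBorel.exists_measurable_quotientMap (hS : IsCountableBorel S) {D : Set Y}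
    (hD : IsFundamentalDomain S D) :
    ∃ q : Y → D, Measurable q ∧ (∀ y, S y (q y)) ∧ ∀ y z, q y = q z ↔ S y z := by
  have : StandardBorelSpace D := hD.1.standardBorel
  obtain ⟨q, hq, hSq⟩ := exists_measurable_uniformization (P := {p : Y × D | S p.1 p.2})
    ((measurable_fst.prodMk (measurable_subtype_coe.comp measurable_snd)) hS.measurableSet)
    (fun y => (hS.countable y).preimage Subtype.val_injective) fun y =>
      let ⟨d, ⟨hd, hyd⟩, _⟩ := hD.2 y
      ⟨⟨d, hd⟩, hyd⟩
  refine ⟨q, hq, hSq, fun y z => ⟨fun h => S.trans (hSq y) (h ▸ S.symm (hSq z)), fun h => ?_⟩⟩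
  exact Subtype.ext ((hD.2 y).unique ⟨(q y).2, hSq y⟩ ⟨(q z).2, S.trans h (hSq z)⟩)

/-- `S.comap g` is the kernel of `g` followed by the quotient map of `S`. -/
theorem IsSmooth.comap (hS : IsCountableBorel S) (h : IsSmooth S) {Z : Type*} [MeasurableSpace Z]
    [StandardBorelSpace Z] {g : Z → Y} (hg : Measurable g) (hc : ∀ y, (g ⁻¹' {y}).Countable) :
    IsSmooth (S.comap g) := by
  obtain ⟨D, hD⟩ := h
  have : StandardBorelSpace D := hD.1.standardBorel
  obtain ⟨q, hq, hSq, hqS⟩ := hS.exists_measurable_quotientMap hD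
  have hker : S.comap g = Setoid.ker (q ∘ g) := Setoid.ext fun z w => (hqS (g z) (g w)).symm
  rw [hker]
  have hq_fib (d : D) : (q ⁻¹' {d}).Countable :=
    (hS.countable d).mono fun y (hy : q y = d) => S.symm (hy ▸ hSq y)
  exact isSmooth_ker (hq.comp hg) fun d => countable_preimage_of_countable_fibres hc (hq_fib d)

end Smooth

namespace RSpace

variable {X : Type u} [MeasurableSpace X] {R : Setoid X} {F F' : RSpace R}

/-- The point `(x, π t) · t` over `x`: the action, with the base point of `t` left implicit. -/
def translate (F : RSpace R) (x : X) (t : F.carrier) (h : R x (F.proj t)) : F.carrier :=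
  F.act x (F.proj t) t h rfl

theorem act_eq_translate {x y : X} {t : F.carrier} (h : R x y) (ht : F.proj t = y) :
    F.act x y t h ht = F.translate x t (ht ▸ h) := by
  subst ht
  rfl

theorem proj_translate {x : X} {t : F.carrier} (h : R x (F.proj t)) :
    F.proj (F.translate x t h) = x :=
  F.proj_act x _ t h rfl

theorem orbitRel_translate {x : X} {t : F.carrier} (h : R x (F.proj t)) :
    F.orbitRel (F.translate x t h) t := by
  have hx := proj_translate h
  refine ⟨hx.symm ▸ h, ?_⟩
  congr 1

theorem rel_proj_of_orbitRel {t t' : F.carrier} (h : F.orbitRel t t') :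
    R (F.proj t) (F.proj t') :=
  h.1

theorem translate_eq_self {x : X} {t : F.carrier} (h : R x (F.proj t)) (hx : F.proj t = x) :
    F.translate x t h = t := by
  subst hx
  exact F.act_self _ t rfl

theorem eq_of_orbitRel_of_proj_eq {t t' : F.carrier} (h : F.orbitRel t t')
    (hproj : F.proj t = F.proj t') : t = t' :=
  let ⟨hR, ht⟩ := h
  ht.symm.trans (translate_eq_self hR hproj.symm)

theorem isCountableBorel_orbitRel (hR : IsCountableBorel R) (F : RSpace R) :
    IsCountableBorel F.orbitRel where
  measurableSet := by
    let Q : Set (F.carrier × F.carrier) := {p | R (F.proj p.1) (F.proj p.2)}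
    have hQ : MeasurableSet Q := ((F.measurable_proj.comp measurable_fst).prodMk
      (F.measurable_proj.comp measurable_snd)) hR.measurableSet
    have htranslate : Measurable fun q : Q => F.translate (F.proj q.1.1) q.1.2 q.2 := by
      let toActDomain (q : Q) : {q : (X × X) × F.carrier // R q.1.1 q.1.2 ∧ F.proj q.2 = q.1.2} :=
        ⟨((F.proj q.1.1, F.proj q.1.2), q.1.2), q.2, rfl⟩
      have htoActDomain : Measurable toActDomain := by
        have h₁ : Measurable fun q : Q => q.1.1 := measurable_fst.comp measurable_subtype_coe
        have h₂ : Measurable fun q : Q => q.1.2 := measurable_snd.comp measurable_subtype_coe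
        exact (((F.measurable_proj.comp h₁).prodMk (F.measurable_proj.comp h₂)).prodMk
          h₂).subtype_mk
      exact F.measurable_act.comp htoActDomain
    have hrel : {p : F.carrier × F.carrier | F.orbitRel p.1 p.2} =
        Subtype.val '' {q : Q | F.translate (F.proj q.1.1) q.1.2 q.2 = q.1.1} := by
      ext ⟨t, t'⟩
      exact ⟨fun ⟨h, ht⟩ => ⟨⟨(t, t'), h⟩, ht, rfl⟩, by rintro ⟨⟨_, h⟩, ht, rfl⟩; exact ⟨h, ht⟩⟩
    rw [hrel]
    exact hQ.subtype_image (measurableSet_eq_fun htranslate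
      (measurable_fst.comp measurable_subtype_coe))
  countable t := (countable_preimage_of_countable_fibres F.countable_fibre
    (hR.countable (F.proj t))).mono fun _ => rel_proj_of_orbitRel

namespace IsMorphism

variable {φ : F.carrier → F'.carrier}

theorem map_translate (hφ : F.IsMorphism F' φ) {x : X} {t : F.carrier} (h : R x (F.proj t)) :
    φ (F.translate x t h) = F'.translate x (φ t) ((hφ.proj_eq t).symm ▸ h) := by
  rw [translate, hφ.map_act, act_eq_translate]

theorem orbitRel (hφ : F.IsMorphism F' φ) {t t' : F.carrier} (h : F.orbitRel t t') :
    F'.orbitRel (φ t) (φ t') := by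
  obtain ⟨hR, ht⟩ := h
  have hφt : φ t = F'.translate (F.proj t) (φ t') _ :=
    (congrArg φ ht).symm.trans (hφ.map_translate hR)
  rw [hφt]
  exact orbitRel_translate _

theorem countable_preimage (hφ : F.IsMorphism F' φ) (t' : F'.carrier) :
    (φ ⁻¹' {t'}).Countable :=
  (F.countable_fibre (F'.proj t')).mono fun t (ht : φ t = t') => by
    rw [mem_preimage, ← hφ.proj_eq, ht, mem_singleton_iff]

end IsMorphism

section QuasiFree

theorem IsPartialSection.injective {A : Set X} {s : A → F.carrier} (hs : F.IsPartialSection A s) :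
    Function.Injective s := fun a b hab =>
  Subtype.ext (by rw [← hs.proj_eq a, ← hs.proj_eq b, hab])

variable [StandardBorelSpace X]

theorem exists_isPartialSection_range_eq {C : Set F.carrier} (hC : MeasurableSet C)
    (hinj : InjOn F.proj C) :
    ∃ (A : Set X) (s : A → F.carrier), F.IsPartialSection A s ∧ range s = C := by
  have : StandardBorelSpace C := hC.standardBorel
  let p : C → X := fun t => F.proj t
  have hp : MeasurableEmbedding p :=
    (F.measurable_proj.comp measurable_subtype_coe).measurableEmbedding hinj.injective
  refine ⟨range p, fun a : range p => (rangeSplitting p a : C),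
    ⟨hp.measurableSet_range, measurable_subtype_coe.comp hp.measurable_rangeSplitting,
      apply_rangeSplitting p⟩, ?_⟩
  have hsurj : Function.Surjective (rangeSplitting p) :=
    (rightInverse_rangeSplitting hp.injective).surjective
  rw [← Function.comp_def, hsurj.range_comp, Subtype.range_coe]

theorem exists_isPartialSection_iUnion_range_eq_univ (F : RSpace R) :
    ∃ (A : ℕ → Set X) (s : ∀ n, A n → F.carrier),
      (∀ n, F.IsPartialSection (A n) (s n)) ∧ ⋃ n, range (s n) = univ := by
  obtain ⟨C, hC, hinj, hCU⟩ := isSigmaInjOn_univ F.measurable_proj F.countable_fibre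
  choose A s hs hsC using fun n => exists_isPartialSection_range_eq (hC n) (hinj n)
  exact ⟨A, s, hs, by rw [hCU]; exact iUnion_congr hsC⟩

theorem IsSmoothAction.isQuasiFree (hR : IsCountableBorel R) (h : F.IsSmoothAction) :
    F.IsQuasiFree := by
  intro A s hs
  have : StandardBorelSpace A := hs.measurableSet_domain.standardBorel
  exact IsSmooth.comap (F.isCountableBorel_orbitRel hR) h hs.measurable fun y =>
    (subsingleton_singleton.preimage hs.injective).countable

/-- Every section of a countable Borel cover of `F` by partial sections contributes the image of a
fundamental domain of its stabilizer, a partial transversal of `R_F`. -/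
theorem IsQuasiFree.isSmoothAction (hR : IsCountableBorel R) (h : F.IsQuasiFree) :
    F.IsSmoothAction := by
  obtain ⟨A, s, hs, hsU⟩ := F.exists_isPartialSection_iUnion_range_eq_univ
  have hA (n : ℕ) : StandardBorelSpace (A n) := (hs n).measurableSet_domain.standardBorel
  choose D hD hDu using fun n => h (A n) (s n) (hs n)
  have hsD (n : ℕ) : MeasurableSet (s n '' D n) :=
    (hD n).image_of_measurable_injOn (hs n).measurable (hs n).injective.injOn
  refine isSmooth_of_iUnion hsD
    (fun n => (F.isCountableBorel_orbitRel hR).measurableSet_saturation (hsD n)) ?_ ?_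
  · rintro n _ ⟨a, ha, rfl⟩ _ ⟨b, hb, rfl⟩ hab
    rw [(hDu n a).unique ⟨ha, F.orbitRel.refl (s n a)⟩ ⟨hb, hab⟩]
  · refine eq_univ_of_univ_subset (hsU ▸ iUnion_mono fun n => ?_)
    rintro _ ⟨a, rfl⟩
    obtain ⟨d, ⟨hd, had⟩, -⟩ := hDu n a
    exact ⟨s n d, mem_image_of_mem _ hd, had⟩

theorem isQuasiFree_iff_isSmoothAction (hR : IsCountableBorel R) (F : RSpace R) :
    F.IsQuasiFree ↔ F.IsSmoothAction :=
  ⟨IsQuasiFree.isSmoothAction hR, IsSmoothAction.isQuasiFree hR⟩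

end QuasiFree

end RSpace

section Graph

variable {V W : Type*} {G : SimpleGraph V}

theorem reachable_of_forall_adj_rel {S : Setoid V} (h : ∀ a b, G.Adj a b → S a b) {a b : V}
    (hab : G.Reachable a b) : S a b := by
  obtain ⟨w⟩ := hab
  induction w with
  | nil => exact S.refl _
  | cons hadj _ ih => exact S.trans (h _ _ hadj) ih

theorem reachable_map {H : SimpleGraph W} {φ : V → W}
    (h : ∀ a b, G.Adj a b → H.Reachable (φ a) (φ b)) {a b : V} (hab : G.Reachable a b) :
    H.Reachable (φ a) (φ b) :=
  reachable_of_forall_adj_rel (S := H.reachableSetoid.comap φ) h hab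

theorem isAcyclic_of_forall_isAcyclic_induce {S : Setoid V} (hS : ∀ a b, G.Adj a b → S a b)
    (h : ∀ a, (G.induce {b | S a b}).IsAcyclic) : G.IsAcyclic := by
  classical
  intro v c hc
  have hsupp : ∀ b ∈ c.support, b ∈ {b | S v b} := fun b hb =>
    reachable_of_forall_adj_rel hS (c.takeUntil b hb).reachable
  refine h v (c.induce _ hsupp) ?_
  rwa [← SimpleGraph.Walk.isCycle_map_iff_of_injective
    (f := (SimpleGraph.Embedding.induce {b | S v b}).toHom) Subtype.val_injective,
    SimpleGraph.Walk.map_induce]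

theorem isTreeing_iff_forall_isTree_induce {X : Type u} [MeasurableSpace X] {S : Setoid X}
    {G : SimpleGraph X} :
    IsTreeing S G ↔ MeasurableSet {p : X × X | G.Adj p.1 p.2} ∧ (∀ x y, G.Adj x y → S x y) ∧
      ∀ x, (G.induce {y | S x y}).IsTree := by
  refine ⟨fun hG => ⟨hG.measurableSet, fun x y h => (hG.reachable_iff x y).1 h.reachable,
    fun x => ?_⟩, fun ⟨hm, hadj, htree⟩ => ⟨hm, fun x y => ?_, ?_⟩⟩
  · have hclass : {y | S x y} = (G.connectedComponentMk x).supp := by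
      ext y
      rw [mem_ofPred_eq, ← hG.reachable_iff, SimpleGraph.ConnectedComponent.mem_supp_iff,
        SimpleGraph.ConnectedComponent.eq, SimpleGraph.reachable_comm]
    rw [hclass]
    exact hG.isAcyclic.isTree_connectedComponent _
  · exact ⟨reachable_of_forall_adj_rel hadj, fun h => ((htree x).connected.preconnected
      ⟨x, S.refl x⟩ ⟨y, h⟩).map (SimpleGraph.Embedding.induce _).toHom⟩
  · exact isAcyclic_of_forall_isAcyclic_induce hadj fun x => (htree x).isAcyclic

end Graph

section Contraction

variable {V W : Type*} {G : SimpleGraph V} {ρ : V → W}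

theorem reachable_lift {H : SimpleGraph W} (hρ : ∀ a b, ρ a = ρ b → G.Reachable a b)
    (hH : ∀ x y, H.Adj x y → ∃ a b, G.Adj a b ∧ ρ a = x ∧ ρ b = y) {a b : V}
    (hab : H.Reachable (ρ a) (ρ b)) : G.Reachable a b := by
  rw [SimpleGraph.reachable_iff_reflTransGen] at hab
  generalize hy : ρ b = y at hab
  induction hab generalizing b with
  | refl => exact hρ a b hy.symm
  | tail _ hadj ih =>
    obtain ⟨c, d, hcd, hc, hd⟩ := hH _ _ hadj
    exact ((ih hc).trans hcd.reachable).trans (hρ d b (hd.trans hy.symm))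

theorem reachable_map_iff (hρ : ∀ a b, ρ a = ρ b → G.Reachable a b) (a b : V) :
    (G.map ρ).Reachable (ρ a) (ρ b) ↔ G.Reachable a b := by
  refine ⟨reachable_lift (H := G.map ρ) hρ fun x y h => h.2, reachable_map fun a b h => ?_⟩
  by_cases hab : ρ a = ρ b
  · rw [hab]
  · exact SimpleGraph.Adj.reachable ⟨hab, a, b, h, rfl, rfl⟩

/-- The graph of those edges of `G` that are collapsed by `ρ`. -/
def collapsedGraph (G : SimpleGraph V) (ρ : V → W) : SimpleGraph V where
  Adj a b := G.Adj a b ∧ ρ a = ρ b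
  symm := ⟨fun _ _ h => ⟨h.1.symm, h.2.symm⟩⟩
  loopless := ⟨fun a h => G.loopless.irrefl a h.1⟩

theorem collapsedGraph_le : collapsedGraph G ρ ≤ G := fun _ _ h => h.1

theorem isAcyclic_map (hG : G.IsAcyclic)
    (hρ : ∀ a b, ρ a = ρ b → (collapsedGraph G ρ).Reachable a b) : (G.map ρ).IsAcyclic := by
  rw [SimpleGraph.isAcyclic_iff_forall_adj_isBridge] at hG ⊢
  rintro _ _ ⟨hne, a, b, hab, rfl, rfl⟩
  rw [SimpleGraph.isBridge_iff]
  intro hreach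
  refine SimpleGraph.isBridge_iff.1 (hG hab) (reachable_lift (ρ := ρ) (fun c d hcd => ?_) ?_ hreach)
  · refine (hρ c d hcd).mono fun c d h => ?_
    refine (SimpleGraph.deleteEdges_adj).2 ⟨h.1, fun he => hne ?_⟩
    rcases Sym2.eq_iff.1 (mem_singleton_iff.1 he) with ⟨rfl, rfl⟩ | ⟨rfl, rfl⟩
    exacts [h.2, h.2.symm]
  · intro x y hxy
    obtain ⟨⟨-, c, d, hcd, rfl, rfl⟩, hxy⟩ := SimpleGraph.deleteEdges_adj.1 hxy
    refine ⟨c, d, SimpleGraph.deleteEdges_adj.2 ⟨hcd, fun he => hxy ?_⟩, rfl, rfl⟩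
    exact mem_singleton_iff.2 (congrArg (Sym2.map ρ) (mem_singleton_iff.1 he))

theorem measurableSet_adj_map {X Z : Type*} [MeasurableSpace X] [StandardBorelSpace X]
    [MeasurableSpace Z] [StandardBorelSpace Z] {G : SimpleGraph Z}
    (hG : MeasurableSet {p : Z × Z | G.Adj p.1 p.2}) {ρ : Z → X} (hρ : Measurable ρ)
    (hc : ∀ x, (ρ ⁻¹' {x}).Countable) : MeasurableSet {p : X × X | (G.map ρ).Adj p.1 p.2} := by
  have hmap : {p : X × X | (G.map ρ).Adj p.1 p.2} =
      {p | p.1 = p.2}ᶜ ∩ Prod.map ρ ρ '' {p | G.Adj p.1 p.2} := by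
    ext ⟨x, y⟩
    refine and_congr_right fun _ => ⟨?_, ?_⟩
    · rintro ⟨a, b, hab, rfl, rfl⟩
      exact ⟨(a, b), hab, rfl⟩
    · rintro ⟨⟨a, b⟩, hab, heq⟩
      exact ⟨a, b, hab, congrArg Prod.fst heq, congrArg Prod.snd heq⟩
  rw [hmap]
  refine (measurableSet_eq_fun measurable_fst measurable_snd).compl.inter
    (measurableSet_image_of_countable_fibres (hρ.prodMap hρ) hG fun p => ?_)
  refine ((hc p.1).prod (hc p.2)).mono fun q hq => ?_
  exact ⟨congrArg Prod.fst hq.2, congrArg Prod.snd hq.2⟩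

end Contraction

section Leaves

variable {V W : Type*} {G : SimpleGraph W} {q : V → W} {r : W → V}

/-- The graph on `V` in which every point `r (q a)` is the centre of a star with leaves the other
points of its `q`-fibre, the centres being joined as prescribed by `G`. -/
def leafGraph (G : SimpleGraph W) (q : V → W) (r : W → V) : SimpleGraph V :=
  G.map r ⊔ SimpleGraph.fromRel fun a b => b = r (q a)

theorem leafGraph_adj {a b : V} (hr : Function.RightInverse r q) : (leafGraph G q r).Adj a b ↔
    (∃ u v, G.Adj u v ∧ r u = a ∧ r v = b) ∨ a ≠ b ∧ (b = r (q a) ∨ a = r (q b)) := by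
  refine or_congr_left (and_iff_right_of_imp ?_)
  rintro ⟨u, v, huv, rfl, rfl⟩
  exact hr.injective.ne huv.ne

theorem leafGraph_reachable_centre (a : V) : (leafGraph G q r).Reachable a (r (q a)) := by
  by_cases ha : a = r (q a)
  · rw [← ha]
  · exact SimpleGraph.Adj.reachable (Or.inr ⟨ha, Or.inl rfl⟩)

theorem leafGraph_reachable_iff (hr : Function.RightInverse r q) {a b : V} :
    (leafGraph G q r).Reachable a b ↔ G.Reachable (q a) (q b) := by
  refine ⟨reachable_map fun c d h => ?_, fun h => ?_⟩
  · rcases (leafGraph_adj hr).1 h with ⟨u, v, huv, rfl, rfl⟩ | ⟨-, rfl | rfl⟩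
    · rw [hr, hr]
      exact huv.reachable
    all_goals rw [hr]
  · exact ((leafGraph_reachable_centre a).trans (reachable_map (fun u v huv =>
      ((leafGraph_adj hr).2 (Or.inl ⟨u, v, huv, rfl, rfl⟩)).reachable) h)).trans
        (leafGraph_reachable_centre b).symm

theorem leafGraph_isBridge_leaf (hr : Function.RightInverse r q) {a : V} (ha : a ≠ r (q a)) :
    (leafGraph G q r).IsBridge s(a, r (q a)) := by
  have hcentre (u : W) : a ≠ r u := fun h => ha (by rw [h, hr])
  rw [SimpleGraph.isBridge_iff]
  intro hreach
  obtain ⟨b, hab⟩ := SimpleGraph.mem_support_of_reachable ha hreach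
  obtain ⟨hab, hne⟩ := SimpleGraph.deleteEdges_adj.1 hab
  rcases (leafGraph_adj hr).1 hab with ⟨u, v, -, hu, -⟩ | ⟨-, rfl | hb⟩
  exacts [hcentre u hu.symm, hne rfl, hcentre _ hb]

theorem leafGraph_isBridge_centres (hr : Function.RightInverse r q) {u v : W}
    (h : G.IsBridge s(u, v)) : (leafGraph G q r).IsBridge s(r u, r v) := by
  rw [SimpleGraph.isBridge_iff] at h ⊢
  refine fun hreach => h ?_
  have := reachable_map (φ := q) (H := G.deleteEdges {s(u, v)}) (fun a b hab => ?_) hreach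
  · rwa [hr, hr] at this
  · obtain ⟨hab, hne⟩ := SimpleGraph.deleteEdges_adj.1 hab
    rcases (leafGraph_adj hr).1 hab with ⟨u', v', huv, rfl, rfl⟩ | ⟨-, rfl | rfl⟩
    · rw [hr, hr]
      refine (SimpleGraph.deleteEdges_adj.2 ⟨huv, fun he => hne ?_⟩).reachable
      exact mem_singleton_iff.2 (congrArg (Sym2.map r) (mem_singleton_iff.1 he))
    all_goals rw [hr]

theorem leafGraph_isAcyclic (hr : Function.RightInverse r q) (hG : G.IsAcyclic) :
    (leafGraph G q r).IsAcyclic := by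
  rw [SimpleGraph.isAcyclic_iff_forall_adj_isBridge] at hG ⊢
  intro a b hab
  rcases (leafGraph_adj hr).1 hab with ⟨u, v, huv, rfl, rfl⟩ | ⟨hne, rfl | rfl⟩
  · exact leafGraph_isBridge_centres hr (hG huv)
  · exact leafGraph_isBridge_leaf hr hne
  · rw [Sym2.eq_swap]
    exact leafGraph_isBridge_leaf hr hne.symm

end Leaves

section CompleteSection

variable {V : Type*} {G : SimpleGraph V} {A : Set V}

/-- The points at `G`-distance at most `n` from `A`. -/
def thickening (G : SimpleGraph V) (A : Set V) : ℕ → Set V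
  | 0 => A
  | n + 1 => thickening G A n ∪ {z | ∃ w, w ∈ thickening G A n ∧ G.Adj z w}

theorem thickening_mono (G : SimpleGraph V) (A : Set V) : Monotone (thickening G A) :=
  monotone_nat_of_le_succ fun _ => subset_union_left

theorem exists_mem_thickening {z : V} (h : ∃ a ∈ A, G.Reachable z a) :
    ∃ n, z ∈ thickening G A n := by
  obtain ⟨a, ha, ⟨w⟩⟩ := h
  induction w with
  | nil => exact ⟨0, ha⟩
  | cons hadj _ ih =>
    obtain ⟨n, hn⟩ := ih ha
    exact ⟨n + 1, Or.inr ⟨_, hn, hadj⟩⟩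

/-- The pairs `(z, w)` in which `w` is one step closer to `A` than `z`, or `z = w` lies in `A`. -/
def descent (G : SimpleGraph V) (A : Set V) : Set (V × V) :=
  {q | q.1 ∈ A ∧ q.2 = q.1} ∪
    ⋃ n, {q | q.1 ∉ thickening G A n ∧ q.2 ∈ thickening G A n ∧ G.Adj q.1 q.2}

theorem eq_of_mem_descent {z w : V} (h : (z, w) ∈ descent G A) (hz : z ∈ A) : w = z := by
  rcases h with ⟨-, h⟩ | h
  · exact h
  · obtain ⟨n, hn, -⟩ := mem_iUnion.1 h
    exact absurd (thickening_mono G A n.zero_le hz) hn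

theorem eq_or_adj_of_mem_descent {z w : V} (h : (z, w) ∈ descent G A) : w = z ∨ G.Adj z w := by
  rcases h with ⟨-, h⟩ | h
  · exact Or.inl h
  · obtain ⟨n, -, -, h⟩ := mem_iUnion.1 h
    exact Or.inr h

theorem exists_mem_descent {z : V} (h : ∃ a ∈ A, G.Reachable z a) :
    ∃ w, (z, w) ∈ descent G A := by
  obtain ⟨n, hn⟩ := exists_mem_thickening h
  induction n with
  | zero => exact ⟨z, Or.inl ⟨hn, rfl⟩⟩
  | succ n ih =>
    by_cases hz : z ∈ thickening G A n
    · exact ih hz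
    · obtain ⟨w, hw, hzw⟩ := hn.resolve_left hz
      exact ⟨w, Or.inr (mem_iUnion.2 ⟨n, hz, hw, hzw⟩)⟩

theorem exists_iterate_mem_of_descent {p : V → V} (hp : ∀ z, (z, p z) ∈ descent G A) {z : V}
    (h : ∃ a ∈ A, G.Reachable z a) : ∃ n, p^[n] z ∈ A := by
  obtain ⟨n, hn⟩ := exists_mem_thickening h
  clear h
  induction n generalizing z with
  | zero => exact ⟨0, hn⟩
  | succ n ih =>
    rcases hp z with ⟨hz, -⟩ | hz
    · exact ⟨0, hz⟩
    · obtain ⟨m, hm, hpz, -⟩ := mem_iUnion.1 hz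
      have hmn : m ≤ n := Nat.le_of_lt_succ (lt_of_not_ge fun h => hm (thickening_mono G A h hn))
      obtain ⟨k, hk⟩ := ih (thickening_mono G A hmn hpz)
      exact ⟨k + 1, hk⟩

variable [MeasurableSpace V]

theorem exists_measurable_eventualValue {p : V → V} (hp : Measurable p) (hA : MeasurableSet A)
    (hfix : ∀ z ∈ A, p z = z) (hex : ∀ z, ∃ n, p^[n] z ∈ A) :
    ∃ ρ : V → V, Measurable ρ ∧ (∀ z, ρ z ∈ A) ∧ ∀ z n, p^[n] z ∈ A → ρ z = p^[n] z := by
  classical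
  refine ⟨fun z => p^[Nat.find (hex z)] z,
    Measurable.find hp.iterate (fun n => hp.iterate n hA) hex,
    fun z => Nat.find_spec (hex z), fun z n hn => ?_⟩
  obtain ⟨k, hk⟩ := Nat.exists_eq_add_of_le' (Nat.find_min' (hex z) hn)
  rw [hk, Function.iterate_add_apply, Function.iterate_fixed (hfix _ (Nat.find_spec (hex z)))]

variable [StandardBorelSpace V]

theorem measurableSet_thickening (hG : MeasurableSet {p : V × V | G.Adj p.1 p.2})
    (hc : ∀ z, {w | G.Adj z w}.Countable) (hA : MeasurableSet A) (n : ℕ) :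
    MeasurableSet (thickening G A n) := by
  induction n with
  | zero => exact hA
  | succ n ih =>
    exact ih.union (measurableSet_setOf_exists ((measurable_snd ih).inter hG) fun z =>
      (hc z).mono fun _ h => h.2)

theorem measurableSet_descent (hG : MeasurableSet {p : V × V | G.Adj p.1 p.2})
    (hc : ∀ z, {w | G.Adj z w}.Countable) (hA : MeasurableSet A) :
    MeasurableSet (descent G A) := by
  have hT := measurableSet_thickening hG hc hA
  exact ((measurable_fst hA).inter (measurableSet_eq_fun measurable_snd measurable_fst)).union
    (MeasurableSet.iUnion fun n => (measurable_fst (hT n)).compl.inter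
      ((measurable_snd (hT n)).inter hG))

/-- Every point is moved to `A` by iterating a Borel map that steps along edges towards `A`. -/
theorem exists_measurable_retraction (hG : MeasurableSet {p : V × V | G.Adj p.1 p.2})
    (hc : ∀ z, {w | G.Adj z w}.Countable) (hA : MeasurableSet A)
    (hmeet : ∀ z, ∃ a ∈ A, G.Reachable z a) :
    ∃ ρ : V → V, Measurable ρ ∧ (∀ z, ρ z ∈ A) ∧ (∀ a ∈ A, ρ a = a) ∧
      ∀ z, (collapsedGraph G ρ).Reachable z (ρ z) := by
  obtain ⟨p, hpm, hp⟩ := exists_measurable_uniformization (measurableSet_descent hG hc hA)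
    (fun z => ((hc z).insert z).mono fun w h => eq_or_adj_of_mem_descent h)
    (fun z => exists_mem_descent (hmeet z))
  have hfix : ∀ z ∈ A, p z = z := fun z => eq_of_mem_descent (hp z)
  have hex (z : V) : ∃ n, p^[n] z ∈ A := exists_iterate_mem_of_descent hp (hmeet z)
  obtain ⟨ρ, hρm, hρA, hρ⟩ := exists_measurable_eventualValue hpm hA hfix hex
  have hρp (z : V) : ρ z = ρ (p z) := by
    obtain ⟨n, hn⟩ := hex (p z)
    rw [hρ (p z) n hn, hρ z (n + 1) hn, Function.iterate_succ_apply]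
  have hstep (z : V) : (collapsedGraph G ρ).Reachable z (p z) := by
    rcases eq_or_adj_of_mem_descent (hp z) with h | h
    · rw [h]
    · exact SimpleGraph.Adj.reachable ⟨h, hρp z⟩
  have hiter (n : ℕ) (z : V) : (collapsedGraph G ρ).Reachable z (p^[n] z) := by
    induction n with
    | zero => exact .refl z
    | succ n ih => exact ih.trans (Function.iterate_succ_apply' p n z ▸ hstep _)
  refine ⟨ρ, hρm, hρA, fun a ha => hρ a 0 ha, fun z => ?_⟩
  obtain ⟨n, hn⟩ := hex z
  exact hρ z n hn ▸ hiter n z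

end CompleteSection

namespace IsTreeing

variable {X : Type u} [MeasurableSpace X] {R : Setoid X} {G : SimpleGraph X}

theorem rel_of_adj (hG : IsTreeing R G) {x y : X} (h : G.Adj x y) : R x y :=
  (hG.reachable_iff x y).1 h.reachable

theorem countable_adj (hG : IsTreeing R G) (hR : IsCountableBorel R) (x : X) :
    {y | G.Adj x y}.Countable :=
  (hR.countable x).mono fun _ => hG.rel_of_adj

end IsTreeing

section Treeable

variable {X Z : Type u} [MeasurableSpace X] [StandardBorelSpace X] [MeasurableSpace Z]
  [StandardBorelSpace Z] {S : Setoid Z} {g : X → Z}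

/-- Choose one point in every fibre of `g` and attach the rest of the fibre to it as leaves. -/
theorem IsTreeable.comap_of_surjective (h : IsTreeable S) (hg : Measurable g)
    (hc : ∀ z, (g ⁻¹' {z}).Countable) (hsurj : Function.Surjective g) :
    IsTreeable (S.comap g) := by
  obtain ⟨G, hG⟩ := h
  obtain ⟨r, hr, hrg⟩ := exists_measurable_rightInverse hg hc hsurj
  refine ⟨leafGraph G g r, ?_, fun x y => ?_, leafGraph_isAcyclic hrg hG.isAcyclic⟩
  · have hrq : Measurable (r ∘ g) := hr.comp hg
    refine (measurableSet_adj_map hG.measurableSet hr fun x =>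
      (subsingleton_singleton.preimage hrg.injective).countable).union ?_
    exact (measurableSet_eq_fun measurable_fst measurable_snd).compl.inter
      ((measurableSet_eq_fun measurable_snd (hrq.comp measurable_fst)).union
        (measurableSet_eq_fun measurable_fst (hrq.comp measurable_snd)))
  · rw [leafGraph_reachable_iff hrg, hG.reachable_iff]
    rfl

/-- Contract every point onto a nearest point of the range of `g`. -/
theorem IsTreeable.comap_of_injective (hS : IsCountableBorel S) (h : IsTreeable S)
    (hg : Measurable g) (hi : Function.Injective g) (hmeet : ∀ z, ∃ x, S z (g x)) :
    IsTreeable (S.comap g) := by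
  obtain ⟨G, hG⟩ := h
  have hge : MeasurableEmbedding g := hg.measurableEmbedding hi
  obtain ⟨ρ, hρm, hρA, hρfix, hρG⟩ := exists_measurable_retraction hG.measurableSet
    (hG.countable_adj hS) hge.measurableSet_range fun z =>
      let ⟨x, hx⟩ := hmeet z; ⟨g x, mem_range_self x, (hG.reachable_iff _ _).2 hx⟩
  let σ : Z → X := fun z => rangeSplitting g ⟨ρ z, hρA z⟩
  have hσm : Measurable σ := hge.measurable_rangeSplitting.comp hρm.subtype_mk
  have hgσ (z : Z) : g (σ z) = ρ z := apply_rangeSplitting g _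
  have hσg (x : X) : σ (g x) = x := hi ((hgσ _).trans (hρfix _ (mem_range_self x)))
  have hσ_fib {a b : Z} (hab : σ a = σ b) : (collapsedGraph G σ).Reachable a b := by
    have hle : collapsedGraph G ρ ≤ collapsedGraph G σ := fun c d hcd =>
      ⟨hcd.1, hi (by rw [hgσ, hgσ, hcd.2])⟩
    refine ((hρG a).trans ?_).mono hle
    rw [← hgσ a, hab, hgσ b]
    exact (hρG b).symm
  have hσS (z : Z) : S (g (σ z)) z := by
    rw [hgσ, ← hG.reachable_iff]
    exact ((hρG z).mono collapsedGraph_le).symm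
  refine ⟨G.map σ, ?_, fun x y => ?_, isAcyclic_map hG.isAcyclic fun a b => hσ_fib⟩
  · refine measurableSet_adj_map hG.measurableSet hσm fun x => ?_
    exact (hS.countable (g x)).mono fun z (hz : σ z = x) => hz ▸ hσS z
  · rw [Setoid.comap_rel, ← hG.reachable_iff,
      ← reachable_map_iff (ρ := σ) (fun a b hab => (hσ_fib hab).mono collapsedGraph_le), hσg, hσg]

end Treeable

namespace RSpace

variable {X W W' : Type u} [MeasurableSpace X] {R : Setoid X}
  [MeasurableSpace W] [StandardBorelSpace W] [MeasurableSpace W'] [StandardBorelSpace W']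
  {p : W → X} {p' : W' → X}

/-- The `R`-space induced by a countable-to-one Borel map `p : W → X`: its fibre over `x` is the set
of points of `W` lying over the class of `x`, and `R` acts by changing the base point only. -/
def ofMap [StandardBorelSpace X] (hR : IsCountableBorel R) (hp : Measurable p)
    (hc : ∀ x, (p ⁻¹' {x}).Countable) : RSpace R where
  carrier := {q : X × W // R q.1 (p q.2)}
  standardBorel := ((measurable_fst.prodMk (hp.comp measurable_snd))
    hR.measurableSet : MeasurableSet {q : X × W | R q.1 (p q.2)}).standardBorel
  proj q := q.1.1
  measurable_proj := measurable_fst.comp measurable_subtype_coe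
  countable_fibre x := by
    refine (((countable_preimage_of_countable_fibres hc (hR.countable x)).image
      (Prod.mk x)).preimage Subtype.val_injective).mono ?_
    rintro ⟨⟨_, w⟩, h⟩ rfl
    exact ⟨w, h, rfl⟩
  act x _ t h ht := ⟨(x, t.1.2), R.trans h (ht ▸ t.2)⟩
  measurable_act := by
    refine Measurable.subtype_mk (Measurable.prodMk ?_ ?_)
    · exact (measurable_fst.comp measurable_fst).comp measurable_subtype_coe
    · exact (measurable_snd.comp measurable_subtype_coe).comp
        (measurable_snd.comp measurable_subtype_coe)
  proj_act _ _ _ _ _ := rfl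
  act_self := by rintro z t rfl; rfl
  act_act _ _ _ _ _ _ _ := rfl

variable [StandardBorelSpace X] {hR : IsCountableBorel R} {hp : Measurable p}
  {hc : ∀ x, (p ⁻¹' {x}).Countable} {hp' : Measurable p'} {hc' : ∀ x, (p' ⁻¹' {x}).Countable}

/-- The map between induced `R`-spaces given by a map over the quotient of `X` by `R`. -/
def ofMapHom {φ : W → W'} (hφ : ∀ w, R (p w) (p' (φ w))) :
    (ofMap hR hp hc).carrier → (ofMap hR hp' hc').carrier :=
  fun q => ⟨(q.1.1, φ q.1.2), R.trans q.2 (hφ q.1.2)⟩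

theorem isMorphism_ofMapHom {φ : W → W'} (hφm : Measurable φ) (hφ : ∀ w, R (p w) (p' (φ w))) :
    (ofMap hR hp hc).IsMorphism (ofMap hR hp' hc') (ofMapHom hφ) where
  measurable := ((measurable_fst.prodMk (hφm.comp measurable_snd)).comp
    measurable_subtype_coe).subtype_mk
  proj_eq _ := rfl
  map_act _ _ _ _ _ := rfl

theorem orbitRel_ofMap :
    (ofMap hR hp hc).orbitRel = Setoid.ker fun q : (ofMap hR hp hc).carrier => q.1.2 := by
  ext ⟨⟨x, w⟩, h⟩ ⟨⟨x', w'⟩, h'⟩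
  refine ⟨fun ⟨_, heq⟩ => (congrArg (fun q => q.1.2) heq).symm, ?_⟩
  rintro (rfl : w = w')
  exact ⟨R.trans h (R.symm h'), rfl⟩

variable (hR hp hc) in
theorem isSmoothAction_ofMap : (ofMap hR hp hc).IsSmoothAction := by
  rw [IsSmoothAction, orbitRel_ofMap]
  refine isSmooth_ker (measurable_snd.comp measurable_subtype_coe) fun w => ?_
  refine (((hR.countable (p w)).image fun x => (x, w)).preimage Subtype.val_injective).mono ?_
  rintro ⟨⟨x, _⟩, h⟩ rfl
  exact ⟨x, R.symm h, rfl⟩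

end RSpace

namespace IsTreeing

variable {X : Type u} [MeasurableSpace X] {R : Setoid X}
  {G : SimpleGraph X}

theorem countable_edges_with_origin (hR : IsCountableBorel R) (hG : IsTreeing R G) (x : X) :
    ((fun e : {e : X × X // G.Adj e.1 e.2} => e.1.1) ⁻¹' {x}).Countable := by
  refine (((hG.countable_adj hR x).image (Prod.mk x)).preimage Subtype.val_injective).mono ?_
  rintro ⟨⟨_, y⟩, h⟩ rfl
  exact ⟨y, h, rfl⟩

/-- The field of graphs whose fibre over `x` is the restriction of a treeing to the class of `x`. -/
def graphField [StandardBorelSpace X] (hR : IsCountableBorel R) (hG : IsTreeing R G) :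
    GraphField R :=
  have : StandardBorelSpace {e : X × X // G.Adj e.1 e.2} := hG.measurableSet.standardBorel
  { vert := RSpace.ofMap hR measurable_id fun x => countable_singleton x
    edge := RSpace.ofMap (p := fun e : {e : X × X // G.Adj e.1 e.2} => e.1.1) hR
      (measurable_fst.comp measurable_subtype_coe)
      (hG.countable_edges_with_origin hR)
    vert_surjective := fun x => ⟨⟨(x, x), R.refl x⟩, rfl⟩
    origin := RSpace.ofMapHom (φ := fun e => e.1.1) fun _ => R.refl _
    terminus := RSpace.ofMapHom (φ := fun e => e.1.2) fun e => hG.rel_of_adj e.2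
    rev := RSpace.ofMapHom (φ := fun e => ⟨e.1.swap, e.2.symm⟩) fun e => hG.rel_of_adj e.2
    origin_morphism := RSpace.isMorphism_ofMapHom (measurable_fst.comp measurable_subtype_coe) _
    terminus_morphism := RSpace.isMorphism_ofMapHom (measurable_snd.comp measurable_subtype_coe) _
    rev_morphism := RSpace.isMorphism_ofMapHom
      (measurable_swap.comp measurable_subtype_coe).subtype_mk _
    rev_rev := fun _ => rfl
    rev_ne := fun e he => e.1.2.2.ne (congrArg (fun e => e.1.2.1.2) he)
    origin_rev := fun _ => rfl }

variable [StandardBorelSpace X] (hR : IsCountableBorel R) (hG : IsTreeing R G)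

/-- The projection of the fibre over `x` to the class of `x`. -/
def fibreGraphIso (x : X) : (hG.graphField hR).fibreGraph x ≃g G.induce {y | R x y} where
  toFun v := ⟨v.1.1.2, by obtain ⟨⟨⟨_, _⟩, h⟩, rfl⟩ := v; exact h⟩
  invFun y := ⟨⟨(x, y), y.2⟩, rfl⟩
  left_inv := by rintro ⟨⟨⟨_, y⟩, h⟩, rfl⟩; rfl
  right_inv _ := rfl
  map_rel_iff' := by
    rintro ⟨v, rfl⟩ ⟨w, hw⟩
    refine ⟨fun (h : G.Adj v.1.2 w.1.2) => ⟨fun heq => h.ne (congrArg (fun u => u.1.1.2) heq),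
      ⟨(v.1.1, ⟨(v.1.2, w.1.2), h⟩), v.2⟩, rfl, Subtype.ext (Prod.ext hw.symm rfl)⟩, ?_⟩
    rintro ⟨-, e, he, he'⟩
    have hv : e.1.2.1.1 = v.1.2 := congrArg (fun u => u.1.2) he
    have hw : e.1.2.1.2 = w.1.2 := congrArg (fun u => u.1.2) he'
    have hadj : G.Adj e.1.2.1.1 e.1.2.1.2 := e.1.2.2
    rwa [hv, hw] at hadj

theorem isArboretum_graphField : (hG.graphField hR).IsArboretum where
  no_loop e he := e.1.2.2.ne (congrArg (fun v => v.1.2) he)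
  no_multiple _ _ ho ht := Subtype.ext <| Prod.ext (congrArg (fun v => v.1.1) ho) <|
    Subtype.ext <| Prod.ext (congrArg (fun v => v.1.2) ho) (congrArg (fun v => v.1.2) ht)
  isTree x := (hG.fibreGraphIso hR x).isTree_iff.2
    ((isTreeing_iff_forall_isTree_induce.1 hG).2.2 x)

theorem isQuasiFree_graphField : (hG.graphField hR).IsQuasiFree :=
  (RSpace.isSmoothAction_ofMap hR measurable_id fun x => countable_singleton x).isQuasiFree hR

end IsTreeing

namespace GraphField

variable {X Q : Type u} [MeasurableSpace X] {R : Setoid X} {A : GraphField R}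
  {q : A.vert.carrier → Q} {j : Q → X}

/-- The image of a field of graphs under a map `q` on its vertices, with loops removed. For `q` the
quotient map by the action it is the quotient graph, into which every fibre embeds. -/
def quotientGraph (A : GraphField R) (q : A.vert.carrier → Q) : SimpleGraph Q where
  Adj a b := a ≠ b ∧ ∃ e, q (A.origin e) = a ∧ q (A.terminus e) = b
  symm := ⟨by
    rintro _ _ ⟨hne, e, rfl, rfl⟩
    exact ⟨hne.symm, A.rev e, by rw [A.origin_rev], by rw [← A.origin_rev, A.rev_rev]⟩⟩
  loopless := ⟨fun _ h => h.1 rfl⟩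

theorem measurableSet_quotientGraph_adj [MeasurableSpace Q] [StandardBorelSpace Q]
    (hq : Measurable q) (hc : ∀ a, (q ⁻¹' {a}).Countable) :
    MeasurableSet {p : Q × Q | (A.quotientGraph q).Adj p.1 p.2} := by
  let ends : A.edge.carrier → Q × Q := fun e => (q (A.origin e), q (A.terminus e))
  have hends : Measurable ends :=
    (hq.comp A.origin_morphism.measurable).prodMk (hq.comp A.terminus_morphism.measurable)
  have hends_fib (p : Q × Q) : (ends ⁻¹' {p}).Countable :=
    (countable_preimage_of_countable_fibres A.origin_morphism.countable_preimage (hc p.1)).mono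
      fun e he => congrArg Prod.fst he
  have hadj : {p : Q × Q | (A.quotientGraph q).Adj p.1 p.2} =
      {p | p.1 = p.2}ᶜ ∩ ends '' univ := by
    ext ⟨a, b⟩
    simp [quotientGraph, ends]
  rw [hadj]
  exact (measurableSet_eq_fun measurable_fst measurable_snd).compl.inter
    (measurableSet_image_of_countable_fibres hends .univ fun p =>
      (hends_fib p).mono inter_subset_right)

/-- An edge between the orbits of `v` and `w` has a translate in the fibre of `v` and `w`, which
joins `v` and `w` since an orbit meets a fibre in at most one point. -/
theorem fibreGraph_adj_iff (hqR : ∀ v w, q v = q w ↔ A.vert.orbitRel v w) {x : X}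
    {v w : {v : A.vert.carrier // A.vert.proj v = x}} :
    (A.fibreGraph x).Adj v w ↔ (A.quotientGraph q).Adj (q v) (q w) := by
  have hq_inj {v w : A.vert.carrier} (h : q v = q w) (hproj : A.vert.proj v = A.vert.proj w) :
      v = w := RSpace.eq_of_orbitRel_of_proj_eq ((hqR v w).1 h) hproj
  constructor
  · rintro ⟨hne, e, ho, ht⟩
    exact ⟨fun h => hne (Subtype.ext (hq_inj h (v.2.trans w.2.symm))), e, ho ▸ rfl, ht ▸ rfl⟩
  · rintro ⟨hne, e, ho, ht⟩
    have hx : R x (A.edge.proj e) := by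
      rw [← A.origin_morphism.proj_eq, ← v.2]
      exact R.symm (RSpace.rel_proj_of_orbitRel ((hqR _ _).1 ho))
    have heq {φ : A.edge.carrier → A.vert.carrier} (hφ : A.edge.IsMorphism A.vert φ)
        (u : {v : A.vert.carrier // A.vert.proj v = x}) (hu : q (φ e) = q u) :
        φ (A.edge.translate x e hx) = u :=
      hq_inj (((hqR _ _).2 (hφ.orbitRel (RSpace.orbitRel_translate hx))).trans hu)
        (by rw [hφ.proj_eq, RSpace.proj_translate, u.2])
    exact ⟨fun h => hne (h ▸ rfl), A.edge.translate x e hx, heq A.origin_morphism v ho,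
      heq A.terminus_morphism w ht⟩

theorem isTree_induce_quotientGraph (hA : ∀ x, (A.fibreGraph x).IsTree)
    (hqR : ∀ v w, q v = q w ↔ A.vert.orbitRel v w) (hsurj : Function.Surjective q)
    (hj : ∀ v, R (j (q v)) (A.vert.proj v)) (x : X) :
    ((A.quotientGraph q).induce {a | R x (j a)}).IsTree := by
  let toClass (v : {v : A.vert.carrier // A.vert.proj v = x}) : {a | R x (j a)} :=
    ⟨q v, R.symm (by simpa only [v.2] using hj v)⟩
  have hbij : Function.Bijective toClass := by
    refine ⟨fun v w h => Subtype.ext (RSpace.eq_of_orbitRel_of_proj_eq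
      ((hqR v w).1 (congrArg Subtype.val h)) (v.2.trans w.2.symm)), ?_⟩
    rintro ⟨a, ha⟩
    obtain ⟨v, rfl⟩ := hsurj a
    have hx : R x (A.vert.proj v) := R.trans ha (hj v)
    exact ⟨⟨A.vert.translate x v hx, RSpace.proj_translate hx⟩,
      Subtype.ext ((hqR _ _).2 (RSpace.orbitRel_translate hx))⟩
  let iso : A.fibreGraph x ≃g (A.quotientGraph q).induce {a | R x (j a)} :=
    ⟨Equiv.ofBijective toClass hbij, (fibreGraph_adj_iff hqR).symm⟩
  exact iso.isTree_iff.1 (hA x)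

theorem isTreeing_quotientGraph [MeasurableSpace Q] [StandardBorelSpace Q]
    (hA : ∀ x, (A.fibreGraph x).IsTree) (hq : Measurable q)
    (hc : ∀ a, (q ⁻¹' {a}).Countable) (hqR : ∀ v w, q v = q w ↔ A.vert.orbitRel v w)
    (hsurj : Function.Surjective q) (hj : ∀ v, R (j (q v)) (A.vert.proj v)) :
    IsTreeing (R.comap j) (A.quotientGraph q) := by
  refine isTreeing_iff_forall_isTree_induce.2 ⟨measurableSet_quotientGraph_adj hq hc, ?_,
    fun a => isTree_induce_quotientGraph hA hqR hsurj hj (j a)⟩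
  rintro _ _ ⟨-, e, rfl, rfl⟩
  refine R.trans (hj _) (R.trans ?_ (R.symm (hj _)))
  rw [A.origin_morphism.proj_eq, A.terminus_morphism.proj_eq]

theorem isTreeable_comap_vert_proj (hR : IsCountableBorel R) (hA : ∀ x, (A.fibreGraph x).IsTree)
    (h : A.vert.IsSmoothAction) : IsTreeable (R.comap A.vert.proj) := by
  obtain ⟨D, hD⟩ := h
  have hS := A.vert.isCountableBorel_orbitRel hR
  have : StandardBorelSpace D := hD.1.standardBorel
  obtain ⟨q, hq, hSq, hqR⟩ := hS.exists_measurable_quotientMap hD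
  let j : D → X := fun d => A.vert.proj d
  have hj (v : A.vert.carrier) : R (j (q v)) (A.vert.proj v) :=
    R.symm (RSpace.rel_proj_of_orbitRel (hSq v))
  have hc (d : D) : (q ⁻¹' {d}).Countable :=
    (hS.countable d).mono fun v (hv : q v = d) => A.vert.orbitRel.symm (hv ▸ hSq v)
  have hsurj : Function.Surjective q := fun d =>
    ⟨d, Subtype.ext ((hD.2 d).unique ⟨(q d).2, hSq d⟩ ⟨d.2, A.vert.orbitRel.refl d⟩)⟩
  have hcomap : R.comap A.vert.proj = (R.comap j).comap q := Setoid.ext fun v w =>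
    ⟨fun h => R.trans (hj v) (R.trans h (R.symm (hj w))),
      fun h => R.trans (R.symm (hj v)) (R.trans h (hj w))⟩
  rw [hcomap]
  exact IsTreeable.comap_of_surjective ⟨_, isTreeing_quotientGraph hA hq hc hqR hsurj hj⟩ hq hc
    hsurj

theorem isTreeable [StandardBorelSpace X] (A : GraphField R) (hR : IsCountableBorel R)
    (hA : ∀ x, (A.fibreGraph x).IsTree) (h : A.vert.IsSmoothAction) : IsTreeable R := by
  obtain ⟨s, hs, hsp⟩ := exists_measurable_rightInverse A.vert.measurable_proj
    A.vert.countable_fibre A.vert_surjective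
  have hcomap : R = (R.comap A.vert.proj).comap s := Setoid.ext fun x y => by
    simp only [Setoid.comap_rel, hsp x, hsp y]
  rw [hcomap]
  refine IsTreeable.comap_of_injective (hR.comap A.vert.measurable_proj A.vert.countable_fibre)
    (isTreeable_comap_vert_proj hR hA h) hs hsp.injective fun v => ⟨A.vert.proj v, ?_⟩
  rw [Setoid.comap_rel, hsp]

end GraphField

end BorelTrees

/-- A countable Borel equivalence relation on a standard Borel space is treeable if and only if it
acts quasi-freely on an arboretum; moreover an action of it on a standard fibre space is
quasi-free if and only if it is smooth. -/
theorem mainTheorem3 {X : Type u} [MeasurableSpace X] [StandardBorelSpace X] (R : Setoid X)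
    (hR : BorelTrees.IsCountableBorel R) :
    (BorelTrees.IsTreeable R ↔
      ∃ A : BorelTrees.GraphField R, A.IsArboretum ∧ A.IsQuasiFree) ∧
    (∀ F : BorelTrees.RSpace R, F.IsQuasiFree ↔ F.IsSmoothAction) := by
  refine ⟨⟨?_, ?_⟩, BorelTrees.RSpace.isQuasiFree_iff_isSmoothAction hR⟩
  · rintro ⟨G, hG⟩
    exact ⟨hG.graphField hR, hG.isArboretum_graphField hR, hG.isQuasiFree_graphField hR⟩
  · rintro ⟨A, hA, hq⟩
    exact A.isTreeable hR hA.isTree (BorelTrees.RSpace.IsQuasiFree.isSmoothAction hR hq)
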